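/- Let $N\ge 1$, $p>1$, $b>0$, and let $G\in C^1(\mathbb R)$ satisfy $G(0)=0$ and $G(\sigma)\ge b|\sigma|^p$ for all $\sigma\in\mathbb R$. Let $f,g\in C_c^\infty(\mathbb R^N)$ be real-valued with $\int_{\mathbb R^N}g\,dx>0$, and put $r_0=\sup\{|x| : x\in\operatorname{supp} f\cup\operatorname{supp} g\}$. For $\varepsilon>0$ and $0<T\le\infty$ consider the problem $$\partial_t^2u-\Delta u=G(\partial_tu)\ \text{ in }\mathbb R^N\times(0,T),\qquad u(0)=\varepsilon f,\quad \partial_tu(0)=\varepsilon g .$$ A weak solution in $(0,T)$ is a function $u\in C([0,T);H^1(\mathbb R^N))\cap C^1([0,T);L^2(\mathbb R^N))$ with $G(\partial_tu)\in L^1(0,T;L^1(\mathbb R^N))$, $u(0)=\varepsilon f$, $\partial_tu(0)=\varepsilon g$, such that for every $\Psi\in C_c^\infty(\mathbb R^N\times[0,T))$ $$\varepsilon\int_{\mathbb R^N}g\,\Psi(\cdot,0)\,dx+\int_0^T\!\!\int_{\mathbb R^N}G(\partial_tu)\Psi\,dx\,dt=\int_0^T\!\!\int_{\mathbb R^N}\bigl(-\partial_tu\,\partial_t\Psi+\nabla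 u\cdot\nabla\Psi\bigr)\,dx\,dt .$$ Set $\Gamma_G(N,p)=\frac1{p-1}-\frac{N-1}2$, $p_G(N)=\frac{N+1}{N-1}$ for $N\ge2$, and $p_G(1)=\infty$. Then there are constants $\varepsilon_0>0$ and $C>0$, independent of $\varepsilon$, $T$ and $u$ (they may depend on $N,p,b,G,f,g$), such that for every $\varepsilon\in(0,\varepsilon_0]$, every $T\in(0,\infty]$ and every weak solution $u$ in $(0,T)$ with $\operatorname{supp}u\subset\{(x,t):|x|\le r_0+t\}$, $$T\le C\,\varepsilon^{-\Gamma_G(N,p)^{-1}}\quad\text{if }1<p<p_G(N),\qquad T\le\exp\bigl(C\varepsilon^{-(p-1)}\bigr)\quad\text{if }N\ge2,\ p=p_G(N).$$ -/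

import Mathlib

open MeasureTheory Set
open scoped ContDiff

noncomputable section

namespace GlasseyWave

/-- The Euclidean space `ℝ^N`. -/
abbrev Space (N : ℕ) : Type := EuclideanSpace ℝ (Fin N)

/-- The space `L²(ℝ^N)` of real functions. -/
abbrev L2 (N : ℕ) : Type := Lp ℝ 2 (volume : Measure (Space N))

/-- The space `L²(ℝ^N; ℝ^N)` of vector fields. -/
abbrev L2Vec (N : ℕ) : Type := Lp (Space N) 2 (volume : Measure (Space N))

/-- The space `L¹(ℝ^N)` of real functions. -/
abbrev L1 (N : ℕ) : Type := Lp ℝ 1 (volume : Measure (Space N))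

/-- `φ ∈ C_c^∞(ℝ^N)`. -/
def IsTestFunction {N : ℕ} (φ : Space N → ℝ) : Prop :=
  ContDiff ℝ ∞ φ ∧ HasCompactSupport φ

/-- `w` is the weak gradient of `u`. Thus `u ∈ L²(ℝ^N)` belongs to `H¹(ℝ^N)` iff it has a weak
gradient in `L²(ℝ^N; ℝ^N)`, and the norm of `H¹(ℝ^N)` is `(‖u‖² + ‖w‖²)^(1/2)`. -/
def HasWeakGradient {N : ℕ} (u : L2 N) (w : L2Vec N) : Prop :=
  ∀ φ : Space N → ℝ, IsTestFunction φ →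
    ∫ x, u x • gradient φ x = - ∫ x, φ x • w x

/-- The time interval `[0, T)`, where `T = ∞` is allowed. -/
def timeInterval (T : EReal) : Set ℝ := {t : ℝ | 0 ≤ t ∧ (t : EReal) < T}

/-- `Ψ ∈ C_c^∞(ℝ^N × [0, T))`: the restriction to `t ≥ 0` of a smooth function on `ℝ^N × ℝ`
whose support is compact and contained in `ℝ^N × (-∞, T)`. In particular `Ψ(·, 0)` need not
vanish. -/
def IsSpaceTimeTestFunction {N : ℕ} (T : EReal) (Ψ : Space N × ℝ → ℝ) : Prop :=
  ContDiff ℝ ∞ Ψ ∧ HasCompactSupport Ψ ∧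
    tsupport Ψ ⊆ {z : Space N × ℝ | (z.2 : EReal) < T}

/-- `u ∈ C([0, T); H¹(ℝ^N))`, with spatial gradient `w = ∇u`: continuity for the `H¹` norm is
continuity of `u` and of `∇u` in `L²`. -/
def IsContinuousH1 {N : ℕ} (T : EReal) (u : ℝ → L2 N) (w : ℝ → L2Vec N) : Prop :=
  (∀ t ∈ timeInterval T, HasWeakGradient (u t) (w t)) ∧
    ContinuousOn u (timeInterval T) ∧ ContinuousOn w (timeInterval T)

/-- `u ∈ C¹([0, T); L²(ℝ^N))`, with time derivative `v = ∂ₜu` (one-sided at `t = 0`). -/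
def IsC1L2 {N : ℕ} (T : EReal) (u v : ℝ → L2 N) : Prop :=
  (∀ t ∈ timeInterval T, HasDerivWithinAt u (v t) (timeInterval T) t) ∧
    ContinuousOn v (timeInterval T)

/-- `G(v) ∈ L¹(0, T; L¹(ℝ^N))`, as a Bochner space. -/
def IsL1L1 {N : ℕ} (T : EReal) (G : ℝ → ℝ) (v : ℝ → L2 N) : Prop :=
  ∃ h : ℝ → L1 N, IntegrableOn h (timeInterval T) ∧
    ∀ᵐ t ∂(volume.restrict (timeInterval T)), ∀ᵐ x, h t x = G (v t x)

/-- `u` is a weak solution in `(0, T)` of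
`∂ₜ²u - Δu = G(∂ₜu)`, `u(0) = ε f`, `∂ₜu(0) = ε g`.
Here `v = ∂ₜu` and `w = ∇u`; both are determined by `u` on `[0, T)`. -/
def IsWeakSolution {N : ℕ} (G : ℝ → ℝ) (f g : Space N → ℝ) (ε : ℝ) (T : EReal)
    (u : ℝ → L2 N) : Prop :=
  ∃ (v : ℝ → L2 N) (w : ℝ → L2Vec N),
    IsContinuousH1 T u w ∧ IsC1L2 T u v ∧ IsL1L1 T G v ∧
    (∀ᵐ x, u 0 x = ε * f x) ∧ (∀ᵐ x, v 0 x = ε * g x) ∧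
    ∀ Ψ : Space N × ℝ → ℝ, IsSpaceTimeTestFunction T Ψ →
      ε * (∫ x, g x * Ψ (x, 0)) + ∫ t in timeInterval T, ∫ x, G (v t x) * Ψ (x, t) =
        ∫ t in timeInterval T, ∫ x,
          (-(v t x * deriv (fun s : ℝ => Ψ (x, s)) t) +
            inner ℝ (w t x) (gradient (fun y : Space N => Ψ (y, t)) x))

/-- `r₀ = sup {|x| : x ∈ supp (f, g)}`. -/
def dataRadius {N : ℕ} (f g : Space N → ℝ) : ℝ :=
  sSup ((fun x : Space N => ‖x‖) '' (tsupport f ∪ tsupport g))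

/-- `supp u ⊂ {(x, t) ∈ ℝ^N × [0, T] : |x| ≤ r₀ + t}`, for `u` continuous in time with values in
`L²(ℝ^N)`. -/
def SupportedInCone {N : ℕ} (r₀ : ℝ) (T : EReal) (u : ℝ → L2 N) : Prop :=
  ∀ t ∈ timeInterval T, ∀ᵐ x, r₀ + t < ‖x‖ → u t x = 0

/-- The exponent `Γ_G(N, p) = 1/(p-1) - (N-1)/2`. -/
def glasseyGamma (N : ℕ) (p : ℝ) : ℝ := 1 / (p - 1) - ((N : ℝ) - 1) / 2

/-- The Glassey exponent `p_G(N) = (N+1)/(N-1)` for `N ≥ 2`, and `p_G(1) = ∞`. -/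
def glasseyExponent (N : ℕ) : EReal :=
  if N = 1 then ⊤ else ((((N : ℝ) + 1) / ((N : ℝ) - 1) : ℝ) : EReal)

end GlasseyWave

end

/-! The solution is tested against the plane wave `exp (l xᵢ)`, an eigenfunction of the Laplacian
with eigenvalue `l²`; finite propagation lets a compactly supported cutoff replace it. With `y = ∫ u
exp (l xᵢ)` and `α = y'`, the equation becomes `α' = l² y + ∫ G(∂ₜu) exp (l xᵢ)`, so that `K =
e^{-lt} (α + l y)` has derivative `∫ G(∂ₜu) exp (l (xᵢ - t)) ≥ 0`.

Since `U = e^{-lt} y` solves `U' = K - 2lU` and `K` is nondecreasing, `2lU ≤ K` persists from time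
`0`, hence `e^{-lt} α = K - lU ≥ K/2` (`two_mul_le_of_deriv_eq`). Jensen's inequality
(`jensen_weight`) bounds `K'` below by `(K/2)^p` times a negative power of the mass of `exp (l (xᵢ -
t))` on the ball `|x| ≤ r₀ + t`. This mass is only `O((1+t)^((N-1)/2))`, because the wave
concentrates near one pole of the ball (`integral_exp_mul_closedBall_le`).

Thus `K' ≥ c (1+t)^(-(N-1)(p-1)/2) K^p` with `K(0)` a positive multiple of `ε`, and `∫₀ᵃ
(1+s)^(-(N-1)(p-1)/2) ds ≤ C ε^(-(p-1))` for every `a < T` (`integral_weight_le_of_weak_solution`).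
The integral grows like a power below the Glassey exponent and like a logarithm at it. -/

namespace GlasseyWave

/-! ### Weak derivatives in time and comparison for ordinary differential inequalities. -/

/-- A test function in `Ioo 0 a` has a primitive on `[0, ∞)` vanishing at `a` that extends to a
test function in `Iio a`. -/
theorem exists_test_primitive {a : ℝ} {κ : ℝ → ℝ} (hκ : ContDiff ℝ ∞ κ)
    (hκc : HasCompactSupport κ) (hκs : tsupport κ ⊆ Ioo 0 a) :
    ∃ θ : ℝ → ℝ, ContDiff ℝ ∞ θ ∧ HasCompactSupport θ ∧ tsupport θ ⊆ Iio a ∧ θ a = 0 ∧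
      ∀ t, 0 ≤ t → deriv θ t = κ t := by
  obtain ⟨m, hm, hma⟩ : ∃ m < a, ∀ t ∈ tsupport κ, t ≤ m := by
    rcases (tsupport κ).eq_empty_or_nonempty with he | hne
    · exact ⟨a - 1, by linarith, by simp [he]⟩
    · obtain ⟨m, hm, h⟩ := IsCompact.exists_isGreatest hκc hne
      exact ⟨m, (hκs hm).2, h⟩
  have hder : ∀ t, HasDerivAt (fun t => ∫ s in a..t, κ s) (κ t) t := fun t =>
    intervalIntegral.integral_hasDerivAt_right (hκ.continuous.intervalIntegrable _ _)
      hκ.continuous.stronglyMeasurable.stronglyMeasurableAtFilter hκ.continuous.continuousAt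
  have hP : ContDiff ℝ ∞ (fun t => ∫ s in a..t, κ s) := by
    rw [contDiff_infty_iff_deriv]
    refine ⟨fun t => (hder t).differentiableAt, ?_⟩
    rwa [show deriv (fun t => ∫ s in a..t, κ s) = κ from funext fun t => (hder t).deriv]
  -- To the left of the support of `κ` the primitive is a constant, possibly nonzero. This cutoff,
  -- equal to `1` for `t ≥ -1` and `0` for `t ≤ -2`, removes that tail without changing anything on
  -- `[0, ∞)`.
  have hS : ContDiff ℝ ∞ (fun t : ℝ => Real.smoothTransition (t + 2)) :=
    Real.smoothTransition.contDiff.comp (contDiff_id.add contDiff_const)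
  set θ : ℝ → ℝ := fun t => Real.smoothTransition (t + 2) * ∫ s in a..t, κ s with hθ
  have hsupp : tsupport θ ⊆ Icc (-2) m := by
    refine closure_minimal (fun t ht => ?_) isClosed_Icc
    by_contra hcon
    apply ht
    by_cases h2 : t < -2
    · simp [hθ, Real.smoothTransition.zero_of_nonpos (show t + 2 ≤ 0 by linarith)]
    · have hmt : m < t := by
        by_contra h; exact hcon ⟨by linarith, by linarith⟩
      have : ∫ s in a..t, κ s = 0 := by
        rw [intervalIntegral.integral_congr (g := fun _ => 0)]
        · simp
        · intro s hs
          by_contra hne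
          have h1 := hma s (subset_tsupport _ hne)
          have h2 : min a t ≤ s := hs.1
          have := lt_min hm hmt
          linarith
      simp [hθ, this]
  refine ⟨θ, hS.mul hP, ?_, fun t ht => lt_of_le_of_lt (hsupp ht).2 hm, by simp [hθ], ?_⟩
  · exact HasCompactSupport.of_support_subset_isCompact isCompact_Icc
      ((subset_tsupport _).trans hsupp)
  · intro t ht
    have : θ =ᶠ[nhds t] fun t => ∫ s in a..t, κ s := by
      filter_upwards [lt_mem_nhds (show -1 < t by linarith)] with s hs
      simp [hθ, Real.smoothTransition.one_of_one_le (show 1 ≤ s + 2 by linarith)]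
    rw [this.deriv_eq, (hder t).deriv]

/-- A continuous function whose weak derivative on `[0, a)`, with initial value `K₀`, is the
integrable function `B`, is the primitive of `B`. -/
theorem eq_add_integral_of_weak_deriv {K B : ℝ → ℝ} {K₀ a : ℝ} (ha : 0 < a)
    (hK : ContinuousOn K (Icc 0 a)) (hB : IntervalIntegrable B volume 0 a)
    (h : ∀ θ : ℝ → ℝ, ContDiff ℝ ∞ θ → HasCompactSupport θ → tsupport θ ⊆ Iio a →
      θ 0 * K₀ + ∫ t in (0)..a, θ t * B t = - ∫ t in (0)..a, deriv θ t * K t) :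
    EqOn K (fun t => K₀ + ∫ s in (0)..t, B s) (Ioo 0 a) := by
  have hPac : AbsolutelyContinuousOnInterval (fun t => ∫ s in (0)..t, B s) 0 a :=
    hB.absolutelyContinuousOnInterval_intervalIntegral (by simp)
  have hPc : ContinuousOn (fun t => ∫ s in (0)..t, B s) (Icc 0 a) := by
    simpa [uIcc_of_le ha.le] using hPac.continuousOn
  have hDc : ContinuousOn (fun t => K t - (K₀ + ∫ s in (0)..t, B s)) (Icc 0 a) :=
    hK.sub (continuousOn_const.add hPc)
  -- Du Bois-Reymond: every test function `κ` is `θ'` for an admissible `θ`, so the difference is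
  -- orthogonal to all `κ`. As `B` is only integrable, the integration by parts uses absolute
  -- continuity.
  have key : ∀ᵐ t, t ∈ Ioo 0 a → K t - (K₀ + ∫ s in (0)..t, B s) = 0 := by
    refine isOpen_Ioo.ae_eq_zero_of_integral_contDiff_smul_eq_zero
      ((hDc.mono Ioo_subset_Icc_self).locallyIntegrableOn measurableSet_Ioo) ?_
    intro κ hκ hκc hκs
    obtain ⟨θ, hθ, hθc, hθs, hθa, hθd⟩ := exists_test_primitive hκ hκc hκs
    have hθac : AbsolutelyContinuousOnInterval θ 0 a :=
      ((hθ.of_le (by exact_mod_cast le_top)).contDiffOn).absolutelyContinuousOnInterval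
    have h1 : ∫ t in (0)..a, θ t * B t = - ∫ t in (0)..a, κ t * ∫ s in (0)..t, B s := by
      have e1 : ∫ t in (0)..a, θ t * B t
          = ∫ t in (0)..a, θ t * deriv (fun t => ∫ s in (0)..t, B s) t := by
        apply intervalIntegral.integral_congr_ae
        filter_upwards [hB.ae_hasDerivAt_integral] with t ht hmem
        rw [(ht (uIoc_subset_uIcc hmem) 0 (by simp)).deriv]
      rw [e1, hθac.integral_mul_deriv_eq_deriv_mul hPac]
      have e2 : ∫ t in (0)..a, deriv θ t * ∫ s in (0)..t, B s
          = ∫ t in (0)..a, κ t * ∫ s in (0)..t, B s := by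
        apply intervalIntegral.integral_congr
        intro t ht
        rw [uIcc_of_le ha.le] at ht
        simp only [hθd t ht.1]
      rw [e2, hθa, intervalIntegral.integral_same]
      ring
    have h2 : ∫ t in (0)..a, deriv θ t * K t = ∫ t in (0)..a, κ t * K t := by
      apply intervalIntegral.integral_congr
      intro t ht
      rw [uIcc_of_le ha.le] at ht
      simp only [hθd t ht.1]
    have h3 : θ 0 * K₀ = - ∫ t in (0)..a, κ t * K₀ := by
      have e := intervalIntegral.integral_deriv_eq_sub (f := θ) (a := 0) (b := a)
        (fun t _ => (hθ.differentiable (by simp)).differentiableAt)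
        ((hθ.continuous_deriv (by simp)).intervalIntegrable _ _)
      rw [hθa, intervalIntegral.integral_congr (g := κ)] at e
      · rw [intervalIntegral.integral_mul_const, e]; ring
      · intro t ht
        rw [uIcc_of_le ha.le] at ht
        exact hθd t ht.1
    have h0 := h θ hθ hθc hθs
    rw [h1, h2, h3] at h0
    have hκi : ∀ {F : ℝ → ℝ}, ContinuousOn F (Icc 0 a) →
        IntervalIntegrable (fun t => κ t * F t) volume 0 a := fun hF =>
      (hκ.continuous.continuousOn.mul (by rwa [uIcc_of_le ha.le])).intervalIntegrable
    have h4 : ∫ t in (0)..a, κ t * (K t - (K₀ + ∫ s in (0)..t, B s)) = 0 := by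
      have : ∀ t, κ t * (K t - (K₀ + ∫ s in (0)..t, B s))
          = κ t * K t - (κ t * K₀ + κ t * ∫ s in (0)..t, B s) := fun t => by ring
      simp_rw [this]
      rw [intervalIntegral.integral_sub (hκi hK) ((hκi continuousOn_const).add (hκi hPc)),
        intervalIntegral.integral_add (hκi continuousOn_const) (hκi hPc)]
      linarith
    rw [intervalIntegral.integral_of_le ha.le] at h4
    simp only [smul_eq_mul]
    refine (setIntegral_eq_integral_of_forall_compl_eq_zero fun t ht => ?_).symm.trans h4
    have : κ t = 0 := by
      by_contra hne
      have := hκs (subset_tsupport _ hne)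
      exact ht ⟨this.1, this.2.le⟩
    simp [this]
  have h5 := Measure.eqOn_open_of_ae_eq (μ := volume) (U := Ioo 0 a)
    (f := fun t => K t - (K₀ + ∫ s in (0)..t, B s)) (g := fun _ => 0)
    ((ae_restrict_iff' measurableSet_Ioo).2 key) isOpen_Ioo
    (hDc.mono Ioo_subset_Icc_self) continuousOn_const
  intro t ht
  have := h5 ht
  simp only at this ⊢
  linarith

/-- If `U' = K - 2λU` with `K` bounded above by `K t` on `[0, t]`, and `2λ U(0) ≤ K t`,
then `2λ U(t) ≤ K t`. -/
theorem two_mul_le_of_deriv_eq {U K : ℝ → ℝ} {l t : ℝ} (ht : 0 ≤ t)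
    (hUc : ContinuousOn U (Icc 0 t))
    (hU : ∀ s ∈ Ioo 0 t, HasDerivAt U (K s - 2 * l * U s) s)
    (hK : ∀ s ∈ Ioo 0 t, K s ≤ K t) (hl : 0 < l) (h0 : 2 * l * U 0 ≤ K t) :
    2 * l * U t ≤ K t := by
  have hexp : ∀ s, HasDerivAt (fun s => Real.exp (2 * l * s)) (Real.exp (2 * l * s) * (2 * l)) s :=
    fun s => by simpa using ((hasDerivAt_id s).const_mul (2 * l)).exp
  -- With the integrating factor the derivative is `2l e^{2ls} (K s - K t) ≤ 0`.
  have hanti : AntitoneOn (fun s => Real.exp (2 * l * s) * (2 * l * U s - K t)) (Icc 0 t) := by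
    refine antitoneOn_of_hasDerivWithinAt_nonpos (convex_Icc _ _)
      (f' := fun s => Real.exp (2 * l * s) * (2 * l) * (2 * l * U s - K t) +
        Real.exp (2 * l * s) * (2 * l * (K s - 2 * l * U s))) ?_ ?_ ?_
    · exact (by fun_prop : Continuous fun s => Real.exp (2 * l * s)).continuousOn.mul
        ((continuousOn_const.mul hUc).sub continuousOn_const)
    · intro s hs
      rw [interior_Icc] at hs
      exact ((hexp s).mul (((hU s hs).const_mul (2 * l)).sub_const (K t))).hasDerivWithinAt
    · intro s hs
      rw [interior_Icc] at hs
      have : Real.exp (2 * l * s) * (2 * l) * (2 * l * U s - K t) +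
        Real.exp (2 * l * s) * (2 * l * (K s - 2 * l * U s)) =
          Real.exp (2 * l * s) * (2 * l) * (K s - K t) := by ring
      rw [this]
      exact mul_nonpos_of_nonneg_of_nonpos (by positivity) (by linarith [hK s hs])
  have h := hanti (left_mem_Icc.2 ht) (right_mem_Icc.2 ht) ht
  simp only [mul_zero, Real.exp_zero, one_mul] at h
  have h' : Real.exp (2 * l * t) * (2 * l * U t - K t) ≤ 0 := by linarith
  have := nonpos_of_mul_nonpos_right h' (Real.exp_pos _)
  linarith

/-- If `K ≥ K₀ + ∫ w K^p` with `K₀ > 0` then `(p - 1) ∫ w ≤ K₀^{-(p-1)}`. -/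
theorem integral_le_of_integral_inequality {K w : ℝ → ℝ} {K₀ p t : ℝ} (hp : 1 < p) (ht : 0 < t)
    (hK₀ : 0 < K₀) (hK : ContinuousOn K (Icc 0 t)) (hw : Continuous w) (hw0 : ∀ s, 0 ≤ s → 0 ≤ w s)
    (hKpos : ∀ s ∈ Icc 0 t, 0 ≤ K s)
    (h : ∀ s ∈ Ioo 0 t, K₀ + ∫ r in (0)..s, w r * K r ^ p ≤ K s) :
    (p - 1) * ∫ s in (0)..t, w s ≤ K₀ ^ (-(p - 1)) := by
  have hF : ContinuousOn (fun r => w r * K r ^ p) (Icc 0 t) :=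
    hw.continuousOn.mul (hK.rpow_const fun s _ => Or.inr (by linarith))
  have hFi : IntervalIntegrable (fun r => w r * K r ^ p) volume 0 t :=
    ContinuousOn.intervalIntegrable (by rwa [uIcc_of_le ht.le])
  have hLd : ∀ s ∈ Ioo 0 t, HasDerivAt (fun s => K₀ + ∫ r in (0)..s, w r * K r ^ p)
      (w s * K s ^ p) s := by
    intro s hs
    refine HasDerivAt.const_add _ (intervalIntegral.integral_hasDerivAt_right
      (hFi.mono_set ?_) ?_ ?_)
    · rw [uIcc_of_le ht.le, uIcc_of_le hs.1.le]; exact Icc_subset_Icc_right hs.2.le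
    · exact (hF.mono Ioo_subset_Icc_self).stronglyMeasurableAtFilter isOpen_Ioo s hs
    · exact hF.continuousAt (Icc_mem_nhds hs.1 hs.2)
  have hLc : ContinuousOn (fun s => K₀ + ∫ r in (0)..s, w r * K r ^ p) (Icc 0 t) := by
    have := intervalIntegral.continuousOn_primitive_interval' hFi (by simp : (0:ℝ) ∈ uIcc 0 t)
    rw [uIcc_of_le ht.le] at this
    exact continuousOn_const.add this
  have hLK : ∀ s ∈ Icc 0 t, K₀ ≤ K₀ + ∫ r in (0)..s, w r * K r ^ p := by
    intro s hs
    have : 0 ≤ ∫ r in (0)..s, w r * K r ^ p := by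
      refine intervalIntegral.integral_nonneg hs.1 fun r hr => ?_
      exact mul_nonneg (hw0 r hr.1) (Real.rpow_nonneg (hKpos r ⟨hr.1, hr.2.trans hs.2⟩) _)
    linarith
  set L := fun s => K₀ + ∫ r in (0)..s, w r * K r ^ p with hL
  -- `K` need not be differentiable, so its lower bound `L` is used: `L' = w K^p ≥ w L^p` gives
  -- `(L^{-(p-1)})' ≤ -(p-1) w`.
  have hanti : AntitoneOn (fun s => L s ^ (-(p - 1)) + (p - 1) * ∫ r in (0)..s, w r) (Icc 0 t) := by
    refine antitoneOn_of_hasDerivWithinAt_nonpos (convex_Icc _ _)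
      (f' := fun s => w s * K s ^ p * (-(p - 1)) * L s ^ (-(p - 1) - 1) + (p - 1) * w s) ?_ ?_ ?_
    · refine (hLc.rpow_const fun s hs => Or.inl ?_).add (continuousOn_const.mul ?_)
      · exact (hK₀.trans_le (hLK s hs)).ne'
      · exact (intervalIntegral.continuous_primitive
          (fun a b => hw.intervalIntegrable a b) 0).continuousOn
    · intro s hs
      rw [interior_Icc] at hs
      have hpos := hK₀.trans_le (hLK s (Ioo_subset_Icc_self hs))
      exact (((hLd s hs).rpow_const (Or.inl hpos.ne')).add
        ((hw.integral_hasStrictDerivAt 0 s).hasDerivAt.const_mul (p - 1))).hasDerivWithinAt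
    · intro s hs
      rw [interior_Icc] at hs
      have hpos := hK₀.trans_le (hLK s (Ioo_subset_Icc_self hs))
      have e : -(p - 1) - 1 = -p := by ring
      have hle : L s ^ p ≤ K s ^ p := Real.rpow_le_rpow hpos.le (h s hs) (by linarith)
      have h1 : 1 ≤ K s ^ p * L s ^ (-p) := by
        rw [Real.rpow_neg hpos.le, ← div_eq_mul_inv, one_le_div (Real.rpow_pos_of_pos hpos _)]
        exact hle
      rw [e]
      have hw' : 0 ≤ (p - 1) * w s := mul_nonneg (by linarith) (hw0 s hs.1.le)
      nlinarith [mul_le_mul_of_nonneg_left h1 hw']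
  have h0 := hanti (left_mem_Icc.2 ht.le) (right_mem_Icc.2 ht.le) ht.le
  have hLt : 0 ≤ L t ^ (-(p - 1)) :=
    Real.rpow_nonneg (hK₀.le.trans (hLK t (right_mem_Icc.2 ht.le))) _
  have hL0 : L 0 = K₀ := by simp [hL]
  simp only [hL0, intervalIntegral.integral_same, mul_zero, add_zero] at h0
  linarith

/-! ### Mass of the plane wave in a ball. -/

/-- The slice of the ball at `xᵢ = s` lies in a cube of half-side `√(R² - s²) ≤ √(2R(R - s))`. With
`τ = R - s` the integral is at most `e^{lR} R^{n/2}` times a multiple of the convergent integral of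
`e^{-lτ} τ^{n/2}`. The trivial volume bound would give `R^{n+1}` and miss the critical exponent. -/
theorem lintegral_exp_mul_closedBall_le (n : ℕ) (i : Fin (n + 1)) {l : ℝ} (hl : 0 < l) :
    ∃ C > (0 : ℝ), ∀ R : ℝ, 0 ≤ R →
      ∫⁻ x in Metric.closedBall (0 : Space (n + 1)) R, ENNReal.ofReal (Real.exp (l * x i)) ≤
        ENNReal.ofReal (C * Real.exp (l * R) * √R ^ n) := by
  set f : ℝ → ℝ := fun τ => Real.exp (-(l * τ)) * √τ ^ n with hf
  have hint : IntegrableOn f (Ioi 0) := by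
    have := integrableOn_rpow_mul_exp_neg_mul_rpow (p := 1) (s := (n : ℝ) / 2) (b := l)
      (by have : (0 : ℝ) ≤ n / 2 := by positivity
          linarith) one_pos hl
    refine this.congr_fun (fun τ hτ => ?_) measurableSet_Ioi
    have hτ' : (0 : ℝ) ≤ τ := le_of_lt hτ
    simp only [hf, Real.rpow_one, Real.sqrt_eq_rpow]
    rw [← Real.rpow_natCast (τ ^ (1 / 2 : ℝ)) n, ← Real.rpow_mul hτ', mul_comm]
    congr 2
    · ring
    · ring
  have hfin : ∫⁻ τ in Ici 0, ENNReal.ofReal (f τ) ≠ ⊤ := by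
    rw [setLIntegral_congr Ioi_ae_eq_Ici.symm]
    exact (hint.lintegral_lt_top).ne
  set c := (∫⁻ τ in Ici 0, ENNReal.ofReal (f τ)).toReal with hc
  -- The `+ 1` makes the constant positive without a lower bound on `c`.
  refine ⟨(2 * √2) ^ n * (c + 1), by positivity, fun R hR => ?_⟩
  set e : Space (n + 1) → ℝ × (Fin n → ℝ) := fun x =>
    MeasurableEquiv.piFinSuccAbove (fun _ : Fin (n + 1) => ℝ) i (WithLp.ofLp x) with he
  have hmp : MeasurePreserving e volume volume :=
    (volume_preserving_piFinSuccAbove (fun _ : Fin (n + 1) => ℝ) i).comp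
      (PiLp.volume_preserving_ofLp (Fin (n + 1)))
  have he1 : ∀ x, (e x).1 = x i := fun x => rfl
  have he2 : ∀ x j, (e x).2 j = x (i.succAbove j) := fun x j => rfl
  set S : Set (ℝ × (Fin n → ℝ)) :=
    {z | |z.1| ≤ R ∧ ∀ j, |z.2 j| ≤ √(R ^ 2 - z.1 ^ 2)} with hS
  have hSm : MeasurableSet S := by
    have : S = {z | |z.1| ≤ R} ∩ ⋂ j, {z | |z.2 j| ≤ √(R ^ 2 - z.1 ^ 2)} := by
      ext z; simp [hS]
    rw [this]
    exact (measurableSet_le (by fun_prop) (by fun_prop)).inter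
      (MeasurableSet.iInter fun j => measurableSet_le (by fun_prop) (by fun_prop))
  have hsub : Metric.closedBall (0 : Space (n + 1)) R ⊆ e ⁻¹' S := by
    intro x hx
    have hx' : ‖x‖ ≤ R := by simpa using hx
    have hsq : x i ^ 2 + ∑ j, x (i.succAbove j) ^ 2 ≤ R ^ 2 := by
      have h1 := EuclideanSpace.real_norm_sq_eq x
      rw [Fin.sum_univ_succAbove _ i] at h1
      rw [← h1]
      exact pow_le_pow_left₀ (norm_nonneg _) hx' 2
    refine ⟨?_, fun j => ?_⟩
    · rw [he1]
      exact abs_le_of_sq_le_sq (by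
        have : 0 ≤ ∑ j, x (i.succAbove j) ^ 2 := Finset.sum_nonneg fun _ _ => sq_nonneg _
        linarith) hR
    · rw [he1, he2]
      apply Real.abs_le_sqrt
      have := Finset.single_le_sum (f := fun j => x (i.succAbove j) ^ 2)
        (fun _ _ => sq_nonneg _) (Finset.mem_univ j)
      simp only at this
      linarith
  have hslice : ∀ s : ℝ, ∫⁻ y : Fin n → ℝ,
      S.indicator (fun z => ENNReal.ofReal (Real.exp (l * z.1))) (s, y) ≤
        (Ici 0).indicator (fun τ => ENNReal.ofReal (Real.exp (l * R) * (2 * √2) ^ n * √R ^ n) *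
          ENNReal.ofReal (f τ)) (R - s) := by
    intro s
    by_cases hs : |s| ≤ R
    · have hs' := abs_le.1 hs
      rw [indicator_of_mem (show R - s ∈ Ici 0 by simp; linarith)]
      have hle : ∀ y : Fin n → ℝ,
          S.indicator (fun z => ENNReal.ofReal (Real.exp (l * z.1))) (s, y) ≤
          (Icc (fun _ => -√(R ^ 2 - s ^ 2)) (fun _ => √(R ^ 2 - s ^ 2))).indicator
            (fun _ => ENNReal.ofReal (Real.exp (l * s))) y := by
        intro y
        by_cases hy : (s, y) ∈ S
        · rw [indicator_of_mem hy, indicator_of_mem]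
          exact ⟨fun j => (abs_le.1 (hy.2 j)).1, fun j => (abs_le.1 (hy.2 j)).2⟩
        · rw [indicator_of_notMem hy]; exact zero_le
      refine (lintegral_mono hle).trans ?_
      rw [lintegral_indicator measurableSet_Icc, setLIntegral_const, Real.volume_Icc_pi]
      simp only [Finset.prod_const, Finset.card_univ, Fintype.card_fin, sub_neg_eq_add]
      rw [← ENNReal.ofReal_pow (by positivity), ← ENNReal.ofReal_mul (by positivity),
        ← ENNReal.ofReal_mul (by positivity)]
      apply ENNReal.ofReal_le_ofReal
      have hb : √(R ^ 2 - s ^ 2) ≤ √2 * √R * √(R - s) := by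
        rw [← Real.sqrt_mul (by norm_num), ← Real.sqrt_mul (by positivity)]
        apply Real.sqrt_le_sqrt
        nlinarith
      have hexp : Real.exp (l * s) = Real.exp (l * R) * Real.exp (-(l * (R - s))) := by
        rw [← Real.exp_add]; ring_nf
      calc Real.exp (l * s) * (√(R ^ 2 - s ^ 2) + √(R ^ 2 - s ^ 2)) ^ n
          ≤ Real.exp (l * s) * (2 * √2 * √R * √(R - s)) ^ n := by
            gcongr
            linarith
        _ = _ := by rw [hexp, hf]; ring
    · rw [lintegral_eq_zero_of_ae_eq_zero]
      · exact zero_le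
      · exact Filter.Eventually.of_forall fun y => indicator_of_notMem (fun h => hs h.1) _
  calc ∫⁻ x in Metric.closedBall (0 : Space (n + 1)) R, ENNReal.ofReal (Real.exp (l * x i))
      ≤ ∫⁻ x in e ⁻¹' S, ENNReal.ofReal (Real.exp (l * (e x).1)) := lintegral_mono_set hsub
    _ = ∫⁻ z in S, ENNReal.ofReal (Real.exp (l * z.1)) :=
        hmp.setLIntegral_comp_preimage hSm
          (f := fun z => ENNReal.ofReal (Real.exp (l * z.1))) (by fun_prop)
    _ = ∫⁻ s : ℝ, ∫⁻ y : Fin n → ℝ,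
          S.indicator (fun z => ENNReal.ofReal (Real.exp (l * z.1))) (s, y) := by
        rw [← lintegral_indicator hSm, Measure.volume_eq_prod, lintegral_prod]
        exact (Measurable.indicator (by fun_prop) hSm).aemeasurable
    _ ≤ _ := lintegral_mono hslice
    _ = ENNReal.ofReal (Real.exp (l * R) * (2 * √2) ^ n * √R ^ n) *
          ∫⁻ τ in Ici 0, ENNReal.ofReal (f τ) := by
        rw [lintegral_sub_left_eq_self (fun τ => (Ici (0 : ℝ)).indicator (fun τ =>
          ENNReal.ofReal (Real.exp (l * R) * (2 * √2) ^ n * √R ^ n) * ENNReal.ofReal (f τ)) τ) R,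
          lintegral_indicator measurableSet_Ici, lintegral_const_mul _ (by fun_prop)]
    _ = ENNReal.ofReal (Real.exp (l * R) * (2 * √2) ^ n * √R ^ n * c) := by
        rw [← ENNReal.ofReal_toReal hfin, ← ENNReal.ofReal_mul (by positivity)]
    _ ≤ _ := by
        apply ENNReal.ofReal_le_ofReal
        have : 0 ≤ Real.exp (l * R) * (2 * √2) ^ n * √R ^ n := by positivity
        nlinarith

/-- The mass of the plane wave `exp (l (xᵢ - t))` in the cone `|x| ≤ r + t` grows at most like
`t^(n/2)` in dimension `n + 1`. -/
theorem integral_exp_mul_closedBall_le (n : ℕ) (i : Fin (n + 1)) {l r : ℝ} (hl : 0 < l)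
    (hr : 0 ≤ r) :
    ∃ C > (0 : ℝ), ∀ t : ℝ, 0 ≤ t →
      Real.exp (-(l * t)) *
        ∫ x in Metric.closedBall (0 : Space (n + 1)) (r + t), Real.exp (l * x i) ≤
        C * (1 + t) ^ ((n : ℝ) / 2) := by
  obtain ⟨C, hC, h⟩ := lintegral_exp_mul_closedBall_le n i hl
  refine ⟨C * Real.exp (l * r) * √(1 + r) ^ n, by positivity, fun t ht => ?_⟩
  have h1 : ∫ x in Metric.closedBall (0 : Space (n + 1)) (r + t), Real.exp (l * x i) ≤
      C * Real.exp (l * (r + t)) * √(r + t) ^ n := by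
    rw [integral_eq_lintegral_of_nonneg_ae
      (Filter.Eventually.of_forall fun x => (Real.exp_pos _).le)
      (by fun_prop : Continuous fun x : Space (n + 1) => Real.exp (l * x i)).aestronglyMeasurable]
    exact ENNReal.toReal_le_of_le_ofReal (by positivity) (h _ (by linarith))
  have h2 : √(r + t) ^ n ≤ √(1 + r) ^ n * (1 + t) ^ ((n : ℝ) / 2) := by
    have e : (1 + t) ^ ((n : ℝ) / 2) = √(1 + t) ^ n := by
      rw [Real.sqrt_eq_rpow, ← Real.rpow_natCast, ← Real.rpow_mul (by linarith)]
      congr 1; ring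
    rw [e, ← mul_pow, ← Real.sqrt_mul (by linarith)]
    gcongr
    nlinarith
  calc _ ≤ Real.exp (-(l * t)) * (C * Real.exp (l * (r + t)) *
          (√(1 + r) ^ n * (1 + t) ^ ((n : ℝ) / 2))) := by
        gcongr
        exact h1.trans (by gcongr)
    _ = C * Real.exp (l * r) * √(1 + r) ^ n * (1 + t) ^ ((n : ℝ) / 2) *
          (Real.exp (-(l * t)) * Real.exp (l * t)) := by
        rw [mul_add, Real.exp_add]; ring
    _ = _ := by rw [← Real.exp_add]; simp

/-! ### Pairings with test functions and propagation of supports. -/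

variable {N : ℕ}

theorem integrable_smul_of_hasCompactSupport {E : Type*} [NormedAddCommGroup E] [NormedSpace ℝ E]
    {r : ENNReal} (hr : 1 ≤ r) (u : Lp E r (volume : Measure (Space N))) {q : Space N → ℝ}
    (hq : Continuous q) (hqc : HasCompactSupport q) : Integrable (fun x => q x • u x) :=
  ((Lp.memLp u).locallyIntegrable hr).integrable_smul_left_of_hasCompactSupport hq hqc

theorem integrable_mul_of_hasCompactSupport {r : ENNReal} (hr : 1 ≤ r)
    (u : Lp ℝ r (volume : Measure (Space N))) {q : Space N → ℝ}
    (hq : Continuous q) (hqc : HasCompactSupport q) : Integrable (fun x => u x * q x) := by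
  simpa [mul_comm] using integrable_smul_of_hasCompactSupport hr u hq hqc

/-- A continuous functional transfers continuity and differentiability in time from `L²`-valued
curves to scalar moments. -/
theorem exists_L2_pairing {q : Space N → ℝ} (hq : Continuous q) (hqc : HasCompactSupport q) :
    ∃ Q : L2 N →L[ℝ] ℝ, ∀ u, Q u = ∫ x, u x * q x := by
  have hm : MemLp q 2 (volume : Measure (Space N)) := hq.memLp_of_hasCompactSupport hqc
  refine ⟨innerSL ℝ (hm.toLp q), fun u => ?_⟩
  rw [innerSL_apply_apply, L2.inner_def]
  refine integral_congr_ae ?_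
  filter_upwards [hm.coeFn_toLp] with x hx
  simp [hx]

/-- Boundedness on `L¹` makes the moment of the nonlinearity integrable in time. -/
theorem exists_L1_pairing {q : Space N → ℝ} (hq : Continuous q) (hqc : HasCompactSupport q) :
    ∃ Q : L1 N →L[ℝ] ℝ, ∀ h, Q h = ∫ x, h x * q x := by
  obtain ⟨C, hC⟩ := hq.bounded_above_of_compact_support hqc
  refine ⟨LinearMap.mkContinuous
    { toFun := fun h : L1 N => ∫ x, h x * q x
      map_add' := fun h k => ?_
      map_smul' := fun c h => ?_ } C fun h => ?_, fun h => rfl⟩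
  · rw [← integral_add (integrable_mul_of_hasCompactSupport le_rfl h hq hqc)
      (integrable_mul_of_hasCompactSupport le_rfl k hq hqc)]
    refine integral_congr_ae ?_
    filter_upwards [Lp.coeFn_add h k] with x hx
    rw [hx, Pi.add_apply, add_mul]
  · rw [RingHom.id_apply, smul_eq_mul, ← integral_const_mul]
    refine integral_congr_ae ?_
    filter_upwards [Lp.coeFn_smul c h] with x hx
    rw [hx, Pi.smul_apply, smul_eq_mul, mul_assoc]
  · rw [L1.norm_eq_integral_norm, ← integral_const_mul]
    refine norm_integral_le_of_norm_le ((L1.integrable_coeFn h).norm.const_mul C)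
      (Filter.Eventually.of_forall fun x => ?_)
    rw [norm_mul, mul_comm]
    exact mul_le_mul_of_nonneg_right (hC x) (norm_nonneg _)

theorem IsTestFunction.continuous_gradient {q : Space N → ℝ} (hq : IsTestFunction q) :
    Continuous (gradient q) :=
  (InnerProductSpace.toDual ℝ (Space N)).symm.continuous.comp (hq.1.continuous_fderiv (by simp))

theorem gradient_eq_zero_of_notMem_tsupport {q : Space N → ℝ} {x : Space N}
    (hx : x ∉ tsupport q) : gradient q x = 0 := by
  have : fderiv ℝ q x = 0 := by
    by_contra h
    exact hx (support_fderiv_subset ℝ h)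
  simp [gradient, this]

theorem isOpen_lt_norm (r : ℝ) : IsOpen {x : Space N | r < ‖x‖} :=
  isOpen_lt continuous_const continuous_norm

/-- A weak gradient vanishes on the open set where the function vanishes. -/
theorem HasWeakGradient.ae_eq_zero {u : L2 N} {w : L2Vec N} (h : HasWeakGradient u w)
    {U : Set (Space N)} (hU : IsOpen U) (hu : ∀ᵐ x, x ∈ U → u x = 0) :
    ∀ᵐ x, x ∈ U → w x = 0 := by
  refine hU.ae_eq_zero_of_integral_contDiff_smul_eq_zero
    (((Lp.memLp w).locallyIntegrable one_le_two).locallyIntegrableOn U) fun κ hκ hκc hκs => ?_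
  have h1 := h κ ⟨hκ, hκc⟩
  rw [integral_eq_zero_of_ae] at h1
  · exact neg_eq_zero.1 h1.symm
  · filter_upwards [hu] with x hx
    by_cases hxs : x ∈ tsupport κ
    · simp [hx (hκs hxs)]
    · simp [gradient_eq_zero_of_notMem_tsupport hxs]

theorem timeInterval_subset {T : EReal} {t s : ℝ} (hs : s ∈ timeInterval T) (ht : 0 ≤ t) :
    Icc t s ⊆ timeInterval T := fun r hr =>
  ⟨ht.trans hr.1, lt_of_le_of_lt (by exact_mod_cast hr.2) hs.2⟩

theorem exists_gt_mem_timeInterval {T : EReal} {t : ℝ} (ht : t ∈ timeInterval T) :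
    ∃ s, t < s ∧ s ∈ timeInterval T := by
  obtain ⟨s, h1, h2⟩ := EReal.lt_iff_exists_real_btwn.1 ht.2
  have h1' : t < s := by exact_mod_cast h1
  exact ⟨s, h1', ht.1.trans h1'.le, h2⟩

/-- Finite propagation passes to the time derivative. -/
theorem SupportedInCone.derivative {r : ℝ} {T : EReal} {u v : ℝ → L2 N}
    (hs : SupportedInCone r T u) (hd : IsC1L2 T u v) : SupportedInCone r T v := by
  intro t ht
  refine (isOpen_lt_norm (r + t)).ae_eq_zero_of_integral_contDiff_smul_eq_zero
    (((Lp.memLp (v t)).locallyIntegrable one_le_two).locallyIntegrableOn _)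
    fun κ hκ hκc hκs => ?_
  obtain ⟨Q, hQ⟩ := exists_L2_pairing hκ.continuous hκc
  have hQ' : ∫ x, κ x • v t x = Q (v t) := by simp [hQ, mul_comm]
  rw [hQ']
  -- The strict gap keeps `supp κ` outside the growing cone for a short time after `t`, so the
  -- pairing with `u` vanishes there and its right derivative is `0`.
  obtain ⟨m, hm, hκm⟩ : ∃ m > r + t, ∀ x ∈ tsupport κ, m ≤ ‖x‖ := by
    rcases (tsupport κ).eq_empty_or_nonempty with he | hne
    · exact ⟨r + t + 1, by linarith, by simp [he]⟩
    · obtain ⟨x, hx, h⟩ := IsCompact.exists_isMinOn hκc hne continuous_norm.continuousOn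
      exact ⟨‖x‖, hκs hx, h⟩
  obtain ⟨s, hts, hsT⟩ := exists_gt_mem_timeInterval ht
  obtain ⟨s', hts', hs'⟩ := exists_between (lt_min hts (show t < m - r by linarith))
  have hsub : Icc t s' ⊆ timeInterval T :=
    (Icc_subset_Icc_right (hs'.trans_le (min_le_left _ _)).le).trans (timeInterval_subset hsT ht.1)
  have h1 : HasDerivWithinAt (fun s => Q (u s)) (Q (v t)) (Icc t s') t :=
    Q.hasFDerivAt.comp_hasDerivWithinAt t ((hd.1 t ht).mono hsub)
  have h0 : ∀ τ ∈ Icc t s', Q (u τ) = 0 := by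
    intro τ hτ
    rw [hQ]
    refine integral_eq_zero_of_ae ?_
    filter_upwards [hs τ (hsub hτ)] with x hx
    by_cases hxs : x ∈ tsupport κ
    · have := hκm x hxs
      have h3 := hs'.trans_le (min_le_right _ _)
      simp [hx (by linarith [hτ.2])]
    · simp [image_eq_zero_of_notMem_tsupport hxs]
  have h2 : HasDerivWithinAt (fun s => Q (u s)) 0 (Icc t s') t :=
    (hasDerivWithinAt_const t (Icc t s') (0 : ℝ)).congr h0 (h0 t ⟨le_rfl, hts'.le⟩)
  exact (uniqueDiffOn_Icc hts' t ⟨le_rfl, hts'.le⟩).eq_deriv _ h1 h2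

/-! ### Exponential test functions and the second-order equation in time. -/

/-- A test function that coincides with `x ↦ exp (l xᵢ)` on a ball. -/
theorem exists_test_eq_exp (i : Fin N) (l : ℝ) {ρ : ℝ} (hρ : 0 < ρ) :
    ∃ q : Space N → ℝ, IsTestFunction q ∧
      ∀ x, ‖x‖ ≤ ρ → q x = Real.exp (l * x i) := by
  let β : ContDiffBump (0 : Space N) := ⟨ρ, ρ + 1, hρ, by linarith⟩
  refine ⟨fun x => β x * Real.exp (l * x i), ⟨β.contDiff.mul ?_, β.hasCompactSupport.mul_right⟩,
    fun x hx => ?_⟩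
  · exact Real.contDiff_exp.comp (contDiff_const.mul (contDiff_piLp_apply (p := 2)))
  · simp [β.one_of_mem_closedBall (show x ∈ Metric.closedBall 0 ρ by simpa using hx)]

theorem gradient_eq_of_eq_exp {i : Fin N} {l ρ : ℝ} {q : Space N → ℝ}
    (hq : ∀ x, ‖x‖ ≤ ρ → q x = Real.exp (l * x i)) {x : Space N} (hx : ‖x‖ < ρ) :
    gradient q x = (l * q x) • EuclideanSpace.single i 1 := by
  refine HasGradientAt.gradient ?_
  rw [hasGradientAt_iff_hasFDerivAt]
  have h1 : HasFDerivAt (fun x : Space N => Real.exp (l * x i))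
      (Real.exp (l * x i) • l • (EuclideanSpace.proj i : Space N →L[ℝ] ℝ)) x :=
    ((EuclideanSpace.proj i : Space N →L[ℝ] ℝ).hasFDerivAt.const_mul l).exp
  have h2 : (fun x : Space N => Real.exp (l * x i)) =ᶠ[nhds x] q := by
    filter_upwards [(isOpen_lt continuous_norm continuous_const).mem_nhds hx] with y hy
    exact (hq y hy.le).symm
  refine (h1.congr_of_eventuallyEq h2.symm).congr_fderiv ?_
  ext y
  simp [hq x hx.le, EuclideanSpace.inner_single_left]
  ring

/-- On functions supported in a ball, `Δ` acts on `exp (l xᵢ)` as multiplication by `l²`. -/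
theorem integral_inner_gradient_eq {u : L2 N} {w : L2Vec N} (h : HasWeakGradient u w)
    {i : Fin N} {l r ρ : ℝ} (hr : r < ρ) {q : Space N → ℝ} (hqt : IsTestFunction q)
    (hq : ∀ x, ‖x‖ ≤ ρ → q x = Real.exp (l * x i)) (hu : ∀ᵐ x, r < ‖x‖ → u x = 0) :
    ∫ x, inner ℝ (w x) (gradient q x) = - (l ^ 2 * ∫ x, u x * q x) := by
  have hw : ∀ᵐ x, r < ‖x‖ → w x = 0 := h.ae_eq_zero (isOpen_lt_norm r) hu
  have h1 : ∫ x, inner ℝ (w x) (gradient q x)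
      = ∫ x, l * inner ℝ (EuclideanSpace.single i (1 : ℝ)) (q x • w x) := by
    refine integral_congr_ae ?_
    filter_upwards [hw] with x hx
    by_cases hxr : r < ‖x‖
    · simp [hx hxr]
    · rw [gradient_eq_of_eq_exp hq (by linarith), inner_smul_right, inner_smul_right,
        real_inner_comm]
      ring
  -- On the support `∇q = l q eᵢ`, so the weak gradient identity is applied to `q` itself and only
  -- its `i`-th component is needed.
  have h2 : ∫ x, u x • gradient q x
      = (l * ∫ x, u x * q x) • (EuclideanSpace.single i (1 : ℝ) : Space N) := by
    rw [← integral_const_mul, ← integral_smul_const]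
    refine integral_congr_ae ?_
    filter_upwards [hu] with x hx
    by_cases hxr : r < ‖x‖
    · simp [hx hxr]
    · rw [gradient_eq_of_eq_exp hq (by linarith), smul_smul]
      congr 1; ring
  have h3 := h q hqt
  rw [h2] at h3
  rw [h1, integral_const_mul, integral_inner
    (integrable_smul_of_hasCompactSupport one_le_two w hqt.1.continuous hqt.2),
    ← neg_eq_iff_eq_neg.2 h3, inner_neg_right, inner_smul_right]
  simp
  ring

/-- A pair `y' = α` with `α' = l² y + b` weakly on `[0, a)` and `α(0) = m` satisfies
`(e^{-lt} (α + l y))' = e^{-lt} b`. -/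
theorem eq_add_integral_of_weak_second_order {α y b : ℝ → ℝ} {m l a : ℝ} (ha : 0 < a)
    (hα : ContinuousOn α (Icc 0 a)) (hy : ContinuousOn y (Icc 0 a))
    (hyd : ∀ t ∈ Ioo 0 a, HasDerivAt y (α t) t) (hb : IntervalIntegrable b volume 0 a)
    (h : ∀ ϑ : ℝ → ℝ, ContDiff ℝ ∞ ϑ → HasCompactSupport ϑ → tsupport ϑ ⊆ Iio a →
      m * ϑ 0 + ∫ t in (0)..a, ϑ t * b t =
        ∫ t in (0)..a, (-(deriv ϑ t * α t) - l ^ 2 * (ϑ t * y t))) :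
    EqOn (fun t => Real.exp (-(l * t)) * (α t + l * y t))
      (fun t => m + l * y 0 + ∫ s in (0)..t, Real.exp (-(l * s)) * b s) (Ioo 0 a) := by
  have hexp : ContDiff ℝ ∞ fun t : ℝ => Real.exp (-(l * t)) := by fun_prop
  have hexpd : ∀ t, HasDerivAt (fun t : ℝ => Real.exp (-(l * t)))
      (Real.exp (-(l * t)) * -l) t := fun t => by
    simpa using (((hasDerivAt_id t).const_mul l).neg).exp
  refine eq_add_integral_of_weak_deriv ha
    (hexp.continuous.continuousOn.mul (hα.add (continuousOn_const.mul hy)))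
    (hb.continuousOn_mul hexp.continuous.continuousOn) fun θ hθ hθc hθs => ?_
  have hθ1 : Differentiable ℝ θ := hθ.differentiable (by simp)
  have hθ' : Continuous (deriv θ) := hθ.continuous_deriv (by simp)
  have hd : ∀ t, deriv (fun t => Real.exp (-(l * t)) * θ t) t =
      Real.exp (-(l * t)) * -l * θ t + Real.exp (-(l * t)) * deriv θ t := fun t =>
    ((hexpd t).mul (hθ1 t).hasDerivAt).deriv
  have h1 := h (fun t => Real.exp (-(l * t)) * θ t) (hexp.mul hθ) hθc.mul_left
    ((tsupport_mul_subset_right).trans hθs)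
  simp only [hd, mul_zero, neg_zero, Real.exp_zero, one_mul] at h1
  have hUc : ContinuousOn (fun t => θ t * (Real.exp (-(l * t)) * y t)) (Icc 0 a) :=
    hθ.continuous.continuousOn.mul (hexp.continuous.continuousOn.mul hy)
  have hc2 : ContinuousOn (fun t => deriv θ t * (Real.exp (-(l * t)) * y t) +
      θ t * (Real.exp (-(l * t)) * -l * y t + Real.exp (-(l * t)) * α t)) (Icc 0 a) := by
    have := hexp.continuous
    have := hθ.continuous
    fun_prop
  have h2 := intervalIntegral.integral_eq_sub_of_hasDerivAt_of_le ha.le hUc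
    (fun t ht => (hθ1 t).hasDerivAt.mul ((hexpd t).mul (hyd t ht)))
    (by rw [← uIcc_of_le ha.le] at hc2; exact hc2.intervalIntegrable)
  have hθa : θ a = 0 := by
    by_contra hne
    exact lt_irrefl a (hθs (subset_tsupport θ hne))
  simp only [hθa, zero_mul, mul_zero, neg_zero, Real.exp_zero, one_mul, zero_sub] at h2
  have h3 : ∫ t in (0)..a, θ t * (Real.exp (-(l * t)) * b t) =
      ∫ t in (0)..a, Real.exp (-(l * t)) * θ t * b t :=
    intervalIntegral.integral_congr fun t _ => by ring
  have hc3 : ContinuousOn (fun t => deriv θ t * (Real.exp (-(l * t)) * (α t + l * y t)))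
      (Icc 0 a) := by
    have := hexp.continuous
    fun_prop
  -- Testing with `e^{-lt} θ`, the integrand is `-θ' e^{-lt} (α + l y)` plus `l` times the total
  -- derivative of `θ e^{-lt} y`, which contributes only `-l θ(0) y(0)`.
  have h4 : ∫ t in (0)..a, (-((Real.exp (-(l * t)) * -l * θ t +
      Real.exp (-(l * t)) * deriv θ t) * α t) - l ^ 2 * (Real.exp (-(l * t)) * θ t * y t)) =
      (∫ t in (0)..a, -(deriv θ t * (Real.exp (-(l * t)) * (α t + l * y t)))) +
      ∫ t in (0)..a, l * (deriv θ t * (Real.exp (-(l * t)) * y t) +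
      θ t * (Real.exp (-(l * t)) * -l * y t + Real.exp (-(l * t)) * α t)) := by
    rw [← intervalIntegral.integral_add]
    · exact intervalIntegral.integral_congr fun t _ => by ring
    · rw [← uIcc_of_le ha.le] at hc3; exact hc3.neg.intervalIntegrable
    · rw [← uIcc_of_le ha.le] at hc2
      exact (continuousOn_const.mul hc2).intervalIntegrable
  rw [h4, intervalIntegral.integral_neg, intervalIntegral.integral_const_mul, h2] at h1
  rw [h3]
  linarith

/-! ### Jensen's inequality for the nonlinearity. -/

/-- Bernoulli's inequality at `|σ|/s` gives the tangent line of the convex power at `s`. Integrating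
it yields Jensen without normalizing the weight. -/
theorem rpow_ge_tangent {p s σ : ℝ} (hp : 1 < p) (hs : 0 < s) :
    p * s ^ (p - 1) * σ - (p - 1) * s ^ p ≤ |σ| ^ p := by
  have h1 := one_add_mul_self_le_rpow_one_add (s := |σ| / s - 1)
    (by have : 0 ≤ |σ| / s := by positivity
        linarith) hp.le
  rw [show 1 + (|σ| / s - 1) = |σ| / s by ring, Real.div_rpow (abs_nonneg _) hs.le,
    le_div_iff₀ (Real.rpow_pos_of_pos hs _)] at h1
  have h2 : s ^ p = s ^ (p - 1) * s := by
    rw [← Real.rpow_add_one hs.ne']; ring_nf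
  have h3 : (1 + p * (|σ| / s - 1)) * s ^ p = p * s ^ (p - 1) * |σ| - (p - 1) * s ^ p := by
    rw [h2]; field_simp; ring
  have h4 : p * s ^ (p - 1) * σ ≤ p * s ^ (p - 1) * |σ| :=
    mul_le_mul_of_nonneg_left (le_abs_self σ) (by positivity)
  linarith

/-- Jensen's inequality for a power-like nonlinearity with respect to a weight on a ball. -/
theorem jensen_weight {N : ℕ} {G : ℝ → ℝ} {p b R M : ℝ} (hp : 1 < p) (hb : 0 < b) (hG0 : G 0 = 0)
    (hGb : ∀ σ : ℝ, b * |σ| ^ p ≤ G σ) {v : L2 N} {h : L1 N} (hh : ∀ᵐ x, h x = G (v x))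
    (hv : ∀ᵐ x, R < ‖x‖ → v x = 0) {q : Space N → ℝ} (hq : Continuous q)
    (hqc : HasCompactSupport q) (hq0 : ∀ x, ‖x‖ ≤ R → 0 ≤ q x) (hM0 : 0 < M)
    (hM : ∫ x in Metric.closedBall 0 R, q x ≤ M) (hA : 0 < ∫ x, v x * q x) :
    b * (∫ x, v x * q x) ^ p * M ^ (-(p - 1)) ≤ ∫ x, h x * q x := by
  set A := ∫ x, v x * q x with hAdef
  -- At this tangency point `p s^(p-1) A - (p-1) s^p M = s^(p-1) A = A^p M^(-(p-1))`. The mass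
  -- enters with a negative sign, so an upper bound `M` suffices.
  set s := A / M with hs
  have hs0 : 0 < s := div_pos hA hM0
  have hqi : Integrable ((Metric.closedBall 0 R).indicator q) :=
    (hq.integrable_of_hasCompactSupport hqc).indicator Metric.isClosed_closedBall.measurableSet
  have hvi := integrable_mul_of_hasCompactSupport one_le_two v hq hqc
  have h1 : ∫ x, (b * (p * s ^ (p - 1)) * (v x * q x) -
      b * ((p - 1) * s ^ p) * (Metric.closedBall 0 R).indicator q x) ≤ ∫ x, h x * q x := by
    refine integral_mono_ae ((hvi.const_mul _).sub (hqi.const_mul _))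
      (integrable_mul_of_hasCompactSupport le_rfl h hq hqc) ?_
    filter_upwards [hh, hv] with x hx hvx
    by_cases hxR : ‖x‖ ≤ R
    · rw [indicator_of_mem (by simpa using hxR), hx]
      have := mul_le_mul_of_nonneg_left (rpow_ge_tangent (σ := v x) hp hs0) hb.le
      have := mul_le_mul_of_nonneg_right (this.trans (hGb (v x))) (hq0 x hxR)
      linarith
    · rw [indicator_of_notMem (by simpa using hxR), hx, hvx (not_le.1 hxR), hG0]
      simp
  rw [integral_sub (hvi.const_mul _) (hqi.const_mul _), integral_const_mul, integral_const_mul,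
    integral_indicator Metric.isClosed_closedBall.measurableSet, ← hAdef] at h1
  have h2 : b * ((p - 1) * s ^ p) * ∫ x in Metric.closedBall 0 R, q x ≤
      b * ((p - 1) * s ^ p) * M :=
    mul_le_mul_of_nonneg_left hM (by have := sub_pos.2 hp; positivity)
  have h3 : s ^ p * M = s ^ (p - 1) * A := by
    rw [show s ^ p = s ^ (p - 1) * s by rw [← Real.rpow_add_one hs0.ne']; ring_nf, hs]
    field_simp
  have h4 : A ^ p * M ^ (-(p - 1)) = s ^ (p - 1) * A := by
    rw [hs, Real.div_rpow hA.le hM0.le, Real.rpow_neg hM0.le,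
      show A ^ p = A ^ (p - 1) * A by rw [← Real.rpow_add_one hA.ne']; ring_nf]
    field_simp
  have h5 : b * ((p - 1) * s ^ p) * M = b * (p - 1) * (s ^ (p - 1) * A) := by
    rw [← h3]; ring
  calc b * A ^ p * M ^ (-(p - 1)) = b * (s ^ (p - 1) * A) := by rw [mul_assoc, h4]
    _ ≤ _ := by linarith

/-! ### Initial data and the choice of the frequency. -/

theorem norm_le_dataRadius {N : ℕ} {f g : Space N → ℝ} (hf : HasCompactSupport f)
    (hg : HasCompactSupport g) {x : Space N} (hx : x ∈ tsupport f ∪ tsupport g) :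
    ‖x‖ ≤ dataRadius f g :=
  le_csSup ((IsCompact.union hf hg).image continuous_norm).bddAbove (mem_image_of_mem _ hx)

theorem continuous_integral_mul_exp {N : ℕ} {f : Space N → ℝ} (hf : Continuous f)
    (hfc : HasCompactSupport f) (i : Fin N) :
    Continuous fun l : ℝ => ∫ x, f x * Real.exp (l * x i) := by
  have h := continuous_parametric_integral_of_continuous (μ := (volume : Measure (Space N)))
    (f := fun (l : ℝ) (x : Space N) => f x * Real.exp (l * x i)) (by fun_prop)
    (s := tsupport f) hfc
  refine h.congr fun l => setIntegral_eq_integral_of_forall_compl_eq_zero fun x hx => ?_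
  simp [image_eq_zero_of_notMem_tsupport hx]

/-- Both inequalities are strict at `l = 0` because `∫ g > 0`, and persist for small `l` by
continuity. The first gives `K(0) > 0`, the second `2l U(0) ≤ K(0)`. -/
theorem exists_small_frequency {N : ℕ} {f g : Space N → ℝ} (hf : IsTestFunction f)
    (hg : IsTestFunction g) (hI : 0 < ∫ x, g x) (i : Fin N) :
    ∃ l > (0 : ℝ),
      0 < (∫ x, g x * Real.exp (l * x i)) + l * ∫ x, f x * Real.exp (l * x i) ∧
      l * (∫ x, f x * Real.exp (l * x i)) ≤ ∫ x, g x * Real.exp (l * x i) := by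
  have hcf := continuous_integral_mul_exp hf.1.continuous hf.2 i
  have hcg := continuous_integral_mul_exp hg.1.continuous hg.2 i
  have h1 := (hcg.add (continuous_id.mul hcf)).tendsto 0
  have h2 := (hcg.sub (continuous_id.mul hcf)).tendsto 0
  simp only [Pi.add_apply, Pi.sub_apply, Pi.mul_apply, id, zero_mul, Real.exp_zero, mul_one,
    add_zero, sub_zero] at h1 h2
  have h3 := (h1.eventually (lt_mem_nhds hI)).and (h2.eventually (lt_mem_nhds hI))
  obtain ⟨l, hl, hl0⟩ := ((h3.filter_mono nhdsWithin_le_nhds).and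
    (self_mem_nhdsWithin (s := Ioi (0 : ℝ)))).exists
  exact ⟨l, hl0, hl.1, (sub_pos.1 hl.2).le⟩

/-! ### The weak formulation with separated variables. -/

theorem measurableSet_timeInterval (T : EReal) : MeasurableSet (timeInterval T) :=
  OrdConnected.measurableSet ⟨fun _ hs _ ht => timeInterval_subset ht hs.1⟩

theorem setIntegral_timeInterval_eq {T : EReal} {a : ℝ} (ha : a ∈ timeInterval T) {F : ℝ → ℝ}
    (hF : ∀ t, a < t → F t = 0) : ∫ t in timeInterval T, F t = ∫ t in (0)..a, F t := by
  rw [intervalIntegral.integral_of_le ha.1, ← integral_Icc_eq_integral_Ioc]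
  refine setIntegral_eq_of_subset_of_forall_sdiff_eq_zero (measurableSet_timeInterval T)
    (timeInterval_subset ha le_rfl) fun t ht => hF t ?_
  by_contra hcon
  exact ht.2 ⟨ht.1.1, not_lt.1 hcon⟩

theorem gradient_const_mul {N : ℕ} {q : Space N → ℝ} (hq : Differentiable ℝ q) (c : ℝ)
    (x : Space N) : gradient (fun y => c * q y) x = c • gradient q x := by
  simp only [gradient]
  rw [fderiv_const_mul (hq x), map_smulₛₗ]
  rfl

theorem IsTestFunction.isSpaceTimeTestFunction_mul {N : ℕ} {T : EReal} {a : ℝ}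
    (ha : a ∈ timeInterval T) {q : Space N → ℝ} (hq : IsTestFunction q) {ϑ : ℝ → ℝ}
    (hϑ : ContDiff ℝ ∞ ϑ) (hϑc : HasCompactSupport ϑ) (hϑs : tsupport ϑ ⊆ Iio a) :
    IsSpaceTimeTestFunction T fun z : Space N × ℝ => ϑ z.2 * q z.1 := by
  have hsupp : Function.support (fun z : Space N × ℝ => ϑ z.2 * q z.1) ⊆
      tsupport q ×ˢ tsupport ϑ := fun z hz =>
    ⟨subset_tsupport q (right_ne_zero_of_mul hz), subset_tsupport ϑ (left_ne_zero_of_mul hz)⟩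
  refine ⟨(hϑ.comp contDiff_snd).mul (hq.1.comp contDiff_fst),
    HasCompactSupport.of_support_subset_isCompact (hq.2.prod hϑc) hsupp, ?_⟩
  refine (closure_minimal hsupp ((isClosed_tsupport q).prod (isClosed_tsupport ϑ))).trans ?_
  intro z hz
  exact lt_trans (by exact_mod_cast hϑs hz.2) ha.2

/-- The weak formulation tested with `ϑ(t) q(x)`, where `q = exp (l xᵢ)` on the support of the
solution. -/
theorem weak_form_separated {N : ℕ} {G : ℝ → ℝ} {g : Space N → ℝ} {ε r l a ρ : ℝ} {T : EReal}
    {i : Fin N} {u v : ℝ → L2 N} {w : ℝ → L2Vec N} {h : ℝ → L1 N}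
    (hw : ∀ t ∈ timeInterval T, HasWeakGradient (u t) (w t))
    (hh : ∀ᵐ t ∂(volume.restrict (timeInterval T)), ∀ᵐ x, h t x = G (v t x))
    (hweak : ∀ Ψ : Space N × ℝ → ℝ, IsSpaceTimeTestFunction T Ψ →
      ε * (∫ x, g x * Ψ (x, 0)) + ∫ t in timeInterval T, ∫ x, G (v t x) * Ψ (x, t) =
        ∫ t in timeInterval T, ∫ x,
          (-(v t x * deriv (fun s : ℝ => Ψ (x, s)) t) +
            inner ℝ (w t x) (gradient (fun y : Space N => Ψ (y, t)) x)))
    (hu : SupportedInCone r T u) (ha : a ∈ timeInterval T) (hρ : r + a < ρ)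
    {q : Space N → ℝ} (hqt : IsTestFunction q)
    (hq : ∀ x, ‖x‖ ≤ ρ → q x = Real.exp (l * x i))
    {ϑ : ℝ → ℝ} (hϑ : ContDiff ℝ ∞ ϑ) (hϑc : HasCompactSupport ϑ) (hϑs : tsupport ϑ ⊆ Iio a) :
    (ε * ∫ x, g x * q x) * ϑ 0 + ∫ t in (0)..a, ϑ t * ∫ x, h t x * q x =
      ∫ t in (0)..a, (-(deriv ϑ t * ∫ x, v t x * q x) - l ^ 2 * (ϑ t * ∫ x, u t x * q x)) := by
  have hz : ∀ t, a < t → ϑ t = 0 := fun t ht =>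
    image_eq_zero_of_notMem_tsupport fun hmem => lt_asymm ht (hϑs hmem)
  have hdz : ∀ t, a < t → deriv ϑ t = 0 := fun t ht => by
    by_contra hne
    exact lt_asymm ht (hϑs (support_deriv_subset hne))
  have h0 := hweak _ (hqt.isSpaceTimeTestFunction_mul ha hϑ hϑc hϑs)
  have hdq : ∀ (x : Space N) t, deriv (fun s => ϑ s * q x) t = deriv ϑ t * q x := fun x t =>
    deriv_mul_const ((hϑ.differentiable (by simp)) t) _
  simp only [hdq, gradient_const_mul (hqt.1.differentiable (by simp))] at h0
  have e1 : ∫ x, g x * (ϑ 0 * q x) = (∫ x, g x * q x) * ϑ 0 := by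
    rw [← integral_mul_const]; congr 1; ext x; ring
  have e2 : ∫ t in timeInterval T, ∫ x, G (v t x) * (ϑ t * q x) =
      ∫ t in (0)..a, ϑ t * ∫ x, h t x * q x := by
    rw [← setIntegral_timeInterval_eq ha fun t ht => by rw [hz t ht, zero_mul]]
    refine integral_congr_ae ?_
    filter_upwards [hh] with t ht
    rw [← integral_const_mul]
    refine integral_congr_ae ?_
    filter_upwards [ht] with x hx
    rw [hx]; ring
  have e3 : ∫ t in timeInterval T, ∫ x, (-(v t x * (deriv ϑ t * q x)) +
      inner ℝ (w t x) (ϑ t • gradient q x)) =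
      ∫ t in (0)..a, (-(deriv ϑ t * ∫ x, v t x * q x) - l ^ 2 * (ϑ t * ∫ x, u t x * q x)) := by
    rw [setIntegral_timeInterval_eq ha fun t ht => by simp [hz t ht, hdz t ht]]
    refine intervalIntegral.integral_congr fun t ht => ?_
    rw [uIcc_of_le ha.1] at ht
    have htT := timeInterval_subset ha le_rfl ht
    have i1 := (integrable_mul_of_hasCompactSupport one_le_two (v t) hqt.1.continuous
      hqt.2).const_mul (-deriv ϑ t)
    have i2 : Integrable fun x => inner ℝ (w t x) (gradient q x) := by
      have hgm : MemLp (gradient q) 2 (volume : Measure (Space N)) :=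
        hqt.continuous_gradient.memLp_of_hasCompactSupport
          (hqt.2.mono' fun x hx => by
            by_contra hcon
            exact hx (gradient_eq_zero_of_notMem_tsupport hcon))
      refine (L2.integrable_inner (𝕜 := ℝ) (w t) (hgm.toLp _)).congr ?_
      filter_upwards [hgm.coeFn_toLp] with x hx
      rw [hx]
    have e4 : ∀ x, -(v t x * (deriv ϑ t * q x)) + inner ℝ (w t x) (ϑ t • gradient q x) =
        -deriv ϑ t * (v t x * q x) + ϑ t * inner ℝ (w t x) (gradient q x) := fun x => by
      rw [inner_smul_right]; ring
    simp only [e4]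
    rw [integral_add i1 (i2.const_mul _), integral_const_mul, integral_const_mul,
      integral_inner_gradient_eq (hw t htT) (r := r + t) (by linarith [ht.2]) hqt hq (hu t htT)]
    ring
  rw [e1, e2, e3, ← mul_assoc] at h0
  exact h0

/-! ### The integrated differential inequality. -/

/-- The ordinary differential inequality behind the lifespan estimate, in integrated form. -/
theorem integral_weight_le_of_weak_solution {n : ℕ} {p b : ℝ} (hp : 1 < p) (hb : 0 < b)
    {G : ℝ → ℝ} (hG0 : G 0 = 0) (hGb : ∀ σ : ℝ, b * |σ| ^ p ≤ G σ)
    {f g : Space (n + 1) → ℝ} (hf : IsTestFunction f) (hg : IsTestFunction g)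
    (hI : 0 < ∫ x, g x) :
    ∃ C > (0 : ℝ), ∀ ε : ℝ, 0 < ε → ∀ T : EReal, ∀ u : ℝ → L2 (n + 1),
      IsWeakSolution G f g ε T u → SupportedInCone (dataRadius f g) T u →
      ∀ a ∈ timeInterval T, 0 < a →
        ∫ s in (0)..a, (1 + s) ^ (-((n : ℝ) / 2 * (p - 1))) ≤ C * ε ^ (-(p - 1)) := by
  set i : Fin (n + 1) := 0
  obtain ⟨l, hl, hK0, hmf⟩ := exists_small_frequency hf hg hI i
  set mf := ∫ x, f x * Real.exp (l * x i) with hmfdef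
  set mg := ∫ x, g x * Real.exp (l * x i) with hmgdef
  have hr0 : 0 ≤ dataRadius f g := by
    refine Real.sSup_nonneg ?_
    rintro _ ⟨x, _, rfl⟩
    exact norm_nonneg x
  set r := dataRadius f g with hr
  obtain ⟨M, hM, hMle⟩ := integral_exp_mul_closedBall_le n i hl hr0
  have hp1 : 0 < p - 1 := sub_pos.2 hp
  -- The factor `(1/2)^p` comes from `e^{-lt} α ≥ K/2`, the power of `M` from Jensen.
  set c := b * (1 / 2) ^ p * M ^ (-(p - 1)) with hc
  have hc0 : 0 < c := by positivity
  refine ⟨(mg + l * mf) ^ (-(p - 1)) / ((p - 1) * c), by positivity, ?_⟩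
  intro ε hε T u ⟨v, w, ⟨hw, huc, _⟩, hC1, ⟨h, hhi, hh⟩, hu0, _, hweak⟩ hsupp a ha ha0
  have hvsupp := hsupp.derivative hC1
  have hIcc : Icc 0 a ⊆ timeInterval T := timeInterval_subset ha le_rfl
  -- The radius exceeds that of the cone up to time `a`. The cutoff depends on `a`, but no constant
  -- does.
  obtain ⟨q, hqt, hq⟩ := exists_test_eq_exp i l (show 0 < r + a + 1 by linarith)
  obtain ⟨Q, hQ⟩ := exists_L2_pairing hqt.1.continuous hqt.2
  obtain ⟨Q1, hQ1⟩ := exists_L1_pairing hqt.1.continuous hqt.2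
  have hdata : ∀ {k : Space (n + 1) → ℝ}, tsupport k ⊆ tsupport f ∪ tsupport g →
      ∫ x, k x * q x = ∫ x, k x * Real.exp (l * x i) := by
    intro k hk
    refine integral_congr_ae (Filter.Eventually.of_forall fun x => ?_)
    by_cases hx : x ∈ tsupport k
    · have := norm_le_dataRadius hf.2 hg.2 (hk hx)
      simp only [hq x (by linarith)]
    · simp [image_eq_zero_of_notMem_tsupport hx]
  have hy0 : Q (u 0) = ε * mf := by
    rw [hQ, hmfdef, ← hdata subset_union_left, ← integral_const_mul]
    refine integral_congr_ae ?_
    filter_upwards [hu0] with x hx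
    rw [hx]; ring
  have hyd : ∀ t ∈ Ioo 0 a, HasDerivAt (fun t => Q (u t)) (Q (v t)) t := fun t ht =>
    Q.hasFDerivAt.comp_hasDerivAt t ((hC1.1 t (hIcc (Ioo_subset_Icc_self ht))).hasDerivAt
      (Filter.mem_of_superset (Icc_mem_nhds ht.1 ht.2) hIcc))
  have hyc : ContinuousOn (fun t => Q (u t)) (Icc 0 a) :=
    Q.continuous.comp_continuousOn (huc.mono hIcc)
  have hαc : ContinuousOn (fun t => Q (v t)) (Icc 0 a) :=
    Q.continuous.comp_continuousOn (hC1.2.mono hIcc)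
  have hbi : IntervalIntegrable (fun t => Q1 (h t)) volume 0 a := by
    rw [intervalIntegrable_iff_integrableOn_Icc_of_le ha0.le]
    exact Q1.integrable_comp (hhi.mono_set hIcc)
  have hK : EqOn (fun t => Real.exp (-(l * t)) * (Q (v t) + l * Q (u t)))
      (fun t => ε * mg + l * Q (u 0) + ∫ s in (0)..t, Real.exp (-(l * s)) * Q1 (h s))
      (Ioo 0 a) := by
    refine eq_add_integral_of_weak_second_order ha0 hαc hyc hyd hbi fun ϑ hϑ hϑc hϑs => ?_
    have := weak_form_separated hw hh hweak hsupp ha (by linarith : r + a < r + a + 1) hqt hq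
      hϑ hϑc hϑs
    rw [hdata subset_union_right] at this
    simpa only [hQ, hQ1] using this
  have hqpos : ∀ x, ‖x‖ ≤ r + a → 0 ≤ q x := fun x hx => by
    rw [hq x (by linarith)]; exact (Real.exp_pos _).le
  set K₀ := ε * (mg + l * mf) with hK₀
  have hK₀pos : 0 < K₀ := mul_pos hε hK0
  have hK₀eq : ε * mg + l * Q (u 0) = K₀ := by rw [hy0]; ring
  -- From here `K` denotes the integral expression, whose monotonicity and continuity on `[0, a]`
  -- are immediate; it equals `e^{-lt} (α + l y)` on the open interval.
  rw [hK₀eq] at hK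
  set K : ℝ → ℝ := fun t => K₀ + ∫ s in (0)..t, Real.exp (-(l * s)) * Q1 (h s) with hKdef
  have hbi' : IntervalIntegrable (fun s => Real.exp (-(l * s)) * Q1 (h s)) volume 0 a :=
    hbi.continuousOn_mul (by fun_prop)
  have hhI : ∀ᵐ t, t ∈ Icc 0 a → ∀ᵐ x, h t x = G (v t x) := by
    have := (ae_restrict_iff' (measurableSet_timeInterval T)).1 hh
    filter_upwards [this] with t ht hmem using ht (hIcc hmem)
  have hGnn : ∀ σ, 0 ≤ G σ := fun σ => le_trans (by positivity) (hGb σ)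
  have hBnn : ∀ᵐ t, t ∈ Icc 0 a → 0 ≤ Real.exp (-(l * t)) * Q1 (h t) := by
    filter_upwards [hhI] with t ht hmem
    rw [hQ1]
    refine mul_nonneg (Real.exp_pos _).le (integral_nonneg_of_ae ?_)
    filter_upwards [ht hmem, hvsupp t (hIcc hmem)] with x hx hvx
    by_cases hxr : r + t < ‖x‖
    · simp [hx, hvx hxr, hG0]
    · rw [Pi.zero_apply, hx]
      exact mul_nonneg (hGnn _) (hqpos x (by linarith [hmem.2]))
  have hsubint : ∀ s t, 0 ≤ s → s ≤ t → t ≤ a →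
      IntervalIntegrable (fun s => Real.exp (-(l * s)) * Q1 (h s)) volume s t :=
    fun s t hs hst hta => hbi'.mono_set (by
      rw [uIcc_of_le hst, uIcc_of_le ha0.le]; exact Icc_subset_Icc hs hta)
  have hKmono : ∀ s t, 0 ≤ s → s ≤ t → t ≤ a → K s ≤ K t := by
    intro s t hs hst hta
    have h1 : 0 ≤ ∫ s in s..t, Real.exp (-(l * s)) * Q1 (h s) := by
      refine intervalIntegral.integral_nonneg_of_ae_restrict hst ?_
      refine (ae_restrict_iff' measurableSet_Icc).2 ?_
      filter_upwards [hBnn] with τ hτ hmem using hτ ⟨hs.trans hmem.1, hmem.2.trans hta⟩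
    have h2 := intervalIntegral.integral_add_adjacent_intervals
      (hsubint 0 s le_rfl hs (hst.trans hta)) (hsubint s t hs hst hta)
    simp only [hKdef]
    linarith
  have hKge : ∀ t ∈ Icc 0 a, K₀ ≤ K t := fun t ht => by
    have := hKmono 0 t le_rfl ht.1 ht.2
    simpa [hKdef] using this
  have hexpd : ∀ t, HasDerivAt (fun t : ℝ => Real.exp (-(l * t)))
      (Real.exp (-(l * t)) * -l) t := fun t => by
    simpa using (((hasDerivAt_id t).const_mul l).neg).exp
  have hUK : ∀ t ∈ Ioo 0 a, 2 * l * (Real.exp (-(l * t)) * Q (u t)) ≤ K t := by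
    intro t ht
    refine two_mul_le_of_deriv_eq (U := fun t => Real.exp (-(l * t)) * Q (u t)) ht.1.le ?_ ?_ ?_
      hl ?_
    · exact ContinuousOn.mul (by fun_prop) (hyc.mono (Icc_subset_Icc_right ht.2.le))
    · intro s hs
      have hs' : s ∈ Ioo 0 a := ⟨hs.1, hs.2.trans ht.2⟩
      refine ((hexpd s).mul (hyd s hs')).congr_deriv ?_
      have := hK hs'
      simp only at this
      rw [← this]; ring
    · exact fun s hs => hKmono s t hs.1.le hs.2.le ht.2.le
    · have h1 := hKge t (Ioo_subset_Icc_self ht)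
      simp only [mul_zero, neg_zero, Real.exp_zero, one_mul, hy0]
      have h2 := mul_le_mul_of_nonneg_left hmf hε.le
      have h3 : K₀ = ε * mg + ε * (l * mf) := by rw [hK₀]; ring
      linarith
  have hA : ∀ t ∈ Ioo 0 a, 1 / 2 * K t ≤ Real.exp (-(l * t)) * Q (v t) := by
    intro t ht
    have h1 := hUK t ht
    have h2 := hK ht
    simp only at h2
    linarith
  have hODE : ∀ᵐ t, t ∈ Ioo 0 a →
      -- The absolute value makes the weight continuous on all of `ℝ`.
      c * (1 + |t|) ^ (-((n : ℝ) / 2 * (p - 1))) * K t ^ p ≤ Real.exp (-(l * t)) * Q1 (h t) := by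
    filter_upwards [hhI] with t hht ht
    have htI := Ioo_subset_Icc_self ht
    have hKt : 0 < K t := hK₀pos.trans_le (hKge t htI)
    have hscale : ∀ k : Space (n + 1) → ℝ, ∫ x, k x * (Real.exp (-(l * t)) * q x) =
        Real.exp (-(l * t)) * ∫ x, k x * q x := fun k => by
      rw [← integral_const_mul]; congr 1; ext x; ring
    have hApos : 0 < Real.exp (-(l * t)) * Q (v t) := lt_of_lt_of_le (by positivity) (hA t ht)
    have hball : ∫ x in Metric.closedBall (0 : Space (n + 1)) (r + t),
        Real.exp (-(l * t)) * q x ≤ M * (1 + t) ^ ((n : ℝ) / 2) := by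
      refine le_trans (le_of_eq ?_) (hMle t ht.1.le)
      rw [integral_const_mul]
      congr 1
      refine setIntegral_congr_fun Metric.isClosed_closedBall.measurableSet fun x hx => ?_
      have : ‖x‖ ≤ r + t := by simpa using hx
      exact hq x (by linarith [ht.2])
    have h1t : 0 < 1 + t := by linarith [ht.1]
    have hj := jensen_weight hp hb hG0 hGb (hht htI) (hvsupp t (hIcc htI))
      (q := fun x => Real.exp (-(l * t)) * q x) (continuous_const.mul hqt.1.continuous)
      hqt.2.mul_left
      (fun x hx => mul_nonneg (Real.exp_pos _).le (hqpos x (by linarith [ht.2])))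
      (M := M * (1 + t) ^ ((n : ℝ) / 2)) (by positivity) hball
      (by rw [hscale, ← hQ]; exact hApos)
    rw [hscale, hscale, ← hQ, ← hQ1] at hj
    refine le_trans ?_ hj
    rw [Real.mul_rpow hM.le (by positivity), ← Real.rpow_mul h1t.le, abs_of_pos ht.1, hc]
    have h2 : (1 / 2 * K t) ^ p ≤ (Real.exp (-(l * t)) * Q (v t)) ^ p :=
      Real.rpow_le_rpow (by positivity) (hA t ht) (by linarith)
    rw [Real.mul_rpow (by norm_num) hKt.le] at h2
    calc _ = b * ((1 / 2) ^ p * K t ^ p) *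
          (M ^ (-(p - 1)) * (1 + t) ^ (-((n : ℝ) / 2 * (p - 1)))) := by ring
      _ ≤ b * (Real.exp (-(l * t)) * Q (v t)) ^ p *
          (M ^ (-(p - 1)) * (1 + t) ^ (-((n : ℝ) / 2 * (p - 1)))) := by
        gcongr
      _ = _ := by rw [mul_neg]
  have hwc : Continuous fun t : ℝ => c * (1 + |t|) ^ (-((n : ℝ) / 2 * (p - 1))) :=
    continuous_const.mul ((continuous_const.add continuous_abs).rpow_const fun t =>
      Or.inl (show (0 : ℝ) < 1 + |t| by positivity).ne')
  have hKc : ContinuousOn K (Icc 0 a) := by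
    have := intervalIntegral.continuousOn_primitive_interval' hbi' (by simp : (0:ℝ) ∈ uIcc 0 a)
    rw [uIcc_of_le ha0.le] at this
    exact continuousOn_const.add this
  have hfin := integral_le_of_integral_inequality hp ha0 hK₀pos hKc hwc
    (fun s _ => by positivity) (fun s hs => hK₀pos.le.trans (hKge s hs)) (fun s hs => by
      have : ∫ r in (0)..s, c * (1 + |r|) ^ (-((n : ℝ) / 2 * (p - 1))) * K r ^ p ≤
          ∫ r in (0)..s, Real.exp (-(l * r)) * Q1 (h r) := by
        rw [intervalIntegral.integral_of_le hs.1.le, intervalIntegral.integral_of_le hs.1.le,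
          integral_Ioc_eq_integral_Ioo, integral_Ioc_eq_integral_Ioo]
        refine setIntegral_mono_on_ae ?_ ?_ measurableSet_Ioo ?_
        · refine (ContinuousOn.integrableOn_Icc ?_).mono_set Ioo_subset_Icc_self
          exact hwc.continuousOn.mul ((hKc.mono (Icc_subset_Icc_right hs.2.le)).rpow_const
            fun _ _ => Or.inr (by linarith))
        · exact ((intervalIntegrable_iff_integrableOn_Icc_of_le hs.1.le).1
            (hsubint 0 s le_rfl hs.1.le hs.2.le)).mono_set Ioo_subset_Icc_self
        · filter_upwards [hODE] with τ hτ hmem using hτ ⟨hmem.1, hmem.2.trans hs.2⟩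
      simp only [hKdef] at this ⊢
      linarith)
  have habs : ∫ s in (0)..a, c * (1 + |s|) ^ (-((n : ℝ) / 2 * (p - 1))) =
      c * ∫ s in (0)..a, (1 + s) ^ (-((n : ℝ) / 2 * (p - 1))) := by
    rw [← intervalIntegral.integral_const_mul]
    refine intervalIntegral.integral_congr fun s hs => ?_
    rw [uIcc_of_le ha0.le] at hs
    simp only [abs_of_nonneg hs.1]
  rw [habs, hK₀, Real.mul_rpow hε.le hK0.le] at hfin
  rw [div_mul_eq_mul_div ((mg + l * mf) ^ (-(p - 1))), le_div_iff₀ (by positivity)]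
  linarith

/-! ### From the integral bound to the lifespan. -/

theorem integral_one_add_rpow {α a : ℝ} (ha : 0 ≤ a) (hα : α ≠ 1) :
    ∫ s in (0)..a, (1 + s) ^ (-α) = ((1 + a) ^ (1 - α) - 1) / (1 - α) := by
  rw [intervalIntegral.integral_comp_add_left (fun s : ℝ => s ^ (-α)) 1, integral_rpow]
  · rw [add_zero, Real.one_rpow, show -α + 1 = 1 - α by ring]
  · refine Or.inr ⟨fun h => hα (by linarith), ?_⟩
    rw [uIcc_of_le (by linarith)]
    exact fun h => by linarith [h.1]

theorem integral_one_add_inv {a : ℝ} (ha : 0 ≤ a) :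
    ∫ s in (0)..a, (1 + s) ^ (-1 : ℝ) = Real.log (1 + a) := by
  rw [intervalIntegral.integral_comp_add_left (fun s : ℝ => s ^ (-1 : ℝ)) 1]
  simp only [Real.rpow_neg_one, add_zero]
  rw [integral_inv_of_pos one_pos (by linarith), div_one]

theorem EReal_le_of_forall_mem_timeInterval {T : EReal} {X : ℝ} (hX : 0 ≤ X)
    (h : ∀ a ∈ timeInterval T, 0 < a → a ≤ X) : T ≤ X := by
  by_contra hcon
  obtain ⟨a, h1, h2⟩ := EReal.lt_iff_exists_real_btwn.1 (not_le.1 hcon)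
  have h1' : X < a := by exact_mod_cast h1
  exact absurd (h a ⟨by linarith, h2⟩ (by linarith)) (not_le.2 h1')

end GlasseyWave

open GlasseyWave in
theorem mainTheorem4 (N : ℕ) (hN : 1 ≤ N) (p b : ℝ) (hp : 1 < p) (hb : 0 < b)
    (G : ℝ → ℝ) (hG : ContDiff ℝ 1 G) (hG0 : G 0 = 0) (hGb : ∀ σ : ℝ, b * |σ| ^ p ≤ G σ)
    (f g : GlasseyWave.Space N → ℝ)
    (hf : GlasseyWave.IsTestFunction f) (hg : GlasseyWave.IsTestFunction g)
    (hI : 0 < ∫ x, g x) :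
    ∃ ε₀ > (0 : ℝ), ∃ C > (0 : ℝ),
      ∀ ε : ℝ, 0 < ε → ε ≤ ε₀ →
      ∀ T : EReal, 0 < T →
      ∀ u : ℝ → GlasseyWave.L2 N, GlasseyWave.IsWeakSolution G f g ε T u →
        GlasseyWave.SupportedInCone (GlasseyWave.dataRadius f g) T u →
        ((p : EReal) < GlasseyWave.glasseyExponent N →
          T ≤ ((C * ε ^ (-(GlasseyWave.glasseyGamma N p)⁻¹) : ℝ) : EReal)) ∧
        (2 ≤ N → (p : EReal) = GlasseyWave.glasseyExponent N →
          T ≤ ((Real.exp (C * ε ^ (-(p - 1))) : ℝ) : EReal)) := by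
  obtain ⟨n, rfl⟩ : ∃ n, N = n + 1 := ⟨N - 1, by omega⟩
  obtain ⟨C₀, hC₀, hmain⟩ := integral_weight_le_of_weak_solution (n := n) hp hb hG0 hGb hf hg hI
  have hp1 : 0 < p - 1 := sub_pos.2 hp
  set α := (n : ℝ) / 2 * (p - 1) with hα
  have hΓ : glasseyGamma (n + 1) p = (1 - α) / (p - 1) := by
    rw [glasseyGamma, hα]; push_cast; field_simp; ring
  set D := 1 + |1 - α| * C₀ with hD
  have hD1 : 0 < D := by positivity
  -- One constant for both cases: the first summand serves the subcritical one, `C₀` the critical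
  -- one, where `(1 - α)⁻¹ = 0⁻¹ = 0` is harmless. Taking `ε ≤ 1` gives `ε^(-(p-1)) ≥ 1`, which
  -- absorbs the `1` in `D`.
  refine ⟨1, one_pos, D ^ (1 - α)⁻¹ + C₀, by positivity, ?_⟩
  intro ε hε hε1 T _ u hu hsupp
  have hE : 1 ≤ ε ^ (-(p - 1)) := by
    rw [Real.rpow_neg hε.le]
    exact (one_le_inv₀ (Real.rpow_pos_of_pos hε _)).2 (Real.rpow_le_one hε.le hε1 hp1.le)
  have hJ := hmain ε hε T u hu hsupp
  refine ⟨fun hlt => ?_, fun hn2 heq => ?_⟩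
  -- With `N = n + 1`, `p < (n+2)/n` is exactly `n(p-1)/2 < 1`.
  · have hα1 : α < 1 := by
      rw [glasseyExponent] at hlt
      split_ifs at hlt with hn
      · have : n = 0 := by omega
        simp [hα, this]
      · have hn0 : (0 : ℝ) < n := by exact_mod_cast Nat.pos_of_ne_zero fun h => hn (by omega)
        have h1 : p < ((n + 1 : ℕ) + 1 : ℝ) / ((n + 1 : ℕ) - 1 : ℝ) := by exact_mod_cast hlt
        push_cast at h1
        rw [add_sub_cancel_right, lt_div_iff₀ hn0] at h1
        rw [hα]; nlinarith
    have hα1' : 0 < 1 - α := sub_pos.2 hα1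
    refine EReal_le_of_forall_mem_timeInterval (by positivity) fun a ha ha0 => ?_
    have h1 := hJ a ha ha0
    rw [integral_one_add_rpow ha0.le hα1.ne, div_le_iff₀ hα1'] at h1
    have h2 : (1 + a) ^ (1 - α) ≤ D * ε ^ (-(p - 1)) := by
      rw [hD, abs_of_pos hα1']; linarith
    have h3 : 1 + a ≤ (D * ε ^ (-(p - 1))) ^ (1 - α)⁻¹ := by
      rw [Real.le_rpow_inv_iff_of_pos (by linarith) (by positivity) hα1']
      exact h2
    have hexp : -(glasseyGamma (n + 1) p)⁻¹ = -(p - 1) * (1 - α)⁻¹ := by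
      rw [hΓ, inv_div, div_eq_mul_inv]; ring
    rw [Real.mul_rpow hD1.le (by positivity), ← Real.rpow_mul hε.le, ← hexp] at h3
    have : 0 ≤ C₀ * ε ^ (-(glasseyGamma (n + 1) p)⁻¹) := by positivity
    linarith
  · have hα1 : α = 1 := by
      rw [glasseyExponent, if_neg (by omega)] at heq
      have h1 : p = ((n + 1 : ℕ) + 1 : ℝ) / ((n + 1 : ℕ) - 1 : ℝ) := by exact_mod_cast heq
      have hn0 : (0 : ℝ) < n := by exact_mod_cast (by omega : 0 < n)
      push_cast at h1
      rw [add_sub_cancel_right] at h1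
      rw [hα, h1]; field_simp; ring
    refine EReal_le_of_forall_mem_timeInterval (Real.exp_pos _).le fun a ha ha0 => ?_
    have h1 := hJ a ha ha0
    rw [hα1, integral_one_add_inv ha0.le] at h1
    have h2 : Real.log (1 + a) ≤ (D ^ (1 - α)⁻¹ + C₀) * ε ^ (-(p - 1)) := by
      have : 0 ≤ D ^ (1 - α)⁻¹ * ε ^ (-(p - 1)) := by positivity
      linarith
    have h3 := (Real.log_le_iff_le_exp (by linarith)).1 h2
    linarith
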